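/- **Setting.** Let $\Sigma=\{0,1\}$ and let $\Sigma'$ be the set of finite bit strings. A next token predictor is a map $f:\Sigma'\to\Sigma$; for a response length $T$, its autoregressive map $f^{\mathrm{AR}}:\Sigma'\to\Sigma^T$ sends $x$ to $\mathbf y=(y_1,\dots,y_T)$ with $y_t=f(x\circ y_1\circ\cdots\circ y_{t-1})$. The end-token reward induced by $f_*$ is $r_{f_*}(x,\mathbf y)=\mathbf 1\{\mathbf y[-1]=f_*^{\mathrm{AR}}(x)[-1]\}$, where $[-1]$ denotes the last token. The next token loss of $f$ on $(x,\mathbf y)$ is $\ell(f;x,\mathbf y)=\sum_{t=1}^T\mathbf 1\{f(x\circ y_1\circ\cdots\circ y_{t-1})\ne y_t\}$. Let $P_X$ be a distribution of prompts on $\Sigma'$ and $\pi_{\mathrm{SFT}}(\mathbf y|x)$ a policy on $\Sigma^T$, and let $P_{\mathcal D}=P_X\times\pi_{\mathrm{SFT}}$ be the law of $(x,\mathbf y)$. Given a finite class $\mathcal F$ of predictors and $\mathcal D_n=(x_i,\mathbf y_i)_{i\le n}\sim P_{\mathcal D}^n$, supervised fine-tuning (SFT) outputs $\hat f_{\mathrm{ntp}}$,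 a uniformly random element of $\arg\min_{f\in\mathcal F}\sum_{i=1}^n\ell(f;x_i,\mathbf y_i)$. **Theorem.** Let $d>5$ and $2\le T<d$ be integers. There exist a class $\mathcal F$ of next token predictors with $|\mathcal F|=d$, a target $f_*\in\mathcal F$, a distribution $P_X$ on $\Sigma'$ and a policy $\pi_{\mathrm{SFT}}$ such that 1. the responses are random: for every $x$ in the support of $P_X$, $\pi_{\mathrm{SFT}}(\cdot|x)$ is not a point mass; 2. the responses have expected reward one, $\mathbb E_{P_{\mathcal D}}\,r_{f_*}(x,\mathbf y)=1$, and $$\mathbb E_{P_{\mathcal D}}\,\ell(f_*;x,\mathbf y)+\tfrac12<\min_{f\in\mathcal F\setminus\{f_*\}}\mathbb E_{P_{\mathcal D}}\,\ell(f;x,\mathbf y);$$ 3. for every integer $n\ge 0$ with $n<\tfrac12\,T\log|\mathcal F|$ (natural logarithm), with probability at least $\tfrac14$ over $\mathcal D_n\sim P_{\mathcal D}^n$ and the random tie-breaking, $$\mathbb E_{x\sim P_X}\,r_{f_*}\bigl(x,\hat f_{\mathrm{ntp}}^{\mathrm{AR}}(x)\bigr)=\tfrac12 .$$ -/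

import Mathlib

open scoped ENNReal

namespace SFT

/-- Finite bit strings. -/
abbrev Str : Type := List Bool

/-- Responses: bit strings of length `T`, with tokens indexed by `0, …, T - 1`. -/
abbrev Resp (T : ℕ) : Type := Fin T → Bool

/-- Next token predictors. -/
abbrev Predictor : Type := Str → Bool

/-- Append to a string the token that `f` predicts for it. -/
def app (f : Predictor) (σ : Str) : Str := σ ++ [f σ]

/-- The autoregressive map of `f`: token `t` is `f` applied to the `t`-fold iterate of `app f`. -/
def ar (T : ℕ) (f : Predictor) (x : Str) : Resp T := fun t => f ((app f)^[(t : ℕ)] x)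

/-- The last token of a response (`none` only for the empty response, `T = 0`). -/
def endToken {T : ℕ} (y : Resp T) : Option Bool := (List.ofFn y).getLast?

/-- The end-token reward induced by `fstar`. -/
def reward {T : ℕ} (fstar : Predictor) (x : Str) (y : Resp T) : ℝ≥0∞ :=
  if endToken y = endToken (ar T fstar x) then 1 else 0

/-- The number of tokens of `y` that `f` fails to predict from the prompt and the preceding tokens
of `y`. -/
def ntpLoss {T : ℕ} (f : Predictor) (z : Str × Resp T) : ℕ :=
  ∑ t : Fin T, if f (z.1 ++ (List.ofFn z.2).take (t : ℕ)) ≠ z.2 t then 1 else 0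

/-- The law of one training pair: `x ∼ P`, then `y ∼ π x`. -/
noncomputable def dataLaw {T : ℕ} (P : PMF Str) (π : Str → PMF (Resp T)) : PMF (Str × Resp T) :=
  P.bind fun x => (π x).map fun y => (x, y)

/-- The law of `n` independent draws from `p`. -/
noncomputable def iid {α : Type} (p : PMF α) : (n : ℕ) → PMF (Fin n → α)
  | 0 => PMF.pure Fin.elim0
  | n + 1 => p.bind fun a => (iid p n).map fun D => (Fin.cons a D : Fin (n + 1) → α)

theorem iid_apply {α : Type} (p : PMF α) (n : ℕ) (D : Fin n → α) :
    iid p n D = ∏ i, p (D i) := by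
  classical
  induction n with
  | zero => simp [iid, PMF.pure_apply, Subsingleton.elim D Fin.elim0]
  | succ n ih =>
    rw [iid, PMF.bind_apply, tsum_eq_single (D 0), PMF.map_apply, tsum_eq_single (Fin.tail D),
      Fin.prod_univ_succ, if_pos (Fin.cons_self_tail D).symm, ih]
    · rfl
    · intro E hE
      rw [if_neg]
      intro h
      exact hE (by rw [h, Fin.tail_cons])
    · intro a ha
      rw [PMF.map_apply, ENNReal.tsum_eq_zero.2, mul_zero]
      intro E
      rw [if_neg]
      intro h
      exact ha (by rw [h, Fin.cons_zero])

/-- The expectation of a nonnegative quantity. -/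
noncomputable def expect {α : Type} (p : PMF α) (g : α → ℝ≥0∞) : ℝ≥0∞ := ∑' a, p a * g a

/-- The requirement on the reference policy: its responses have expected reward `1`, and the
expected next token loss of `fstar` is smaller, by more than `1 / 2`, than that of every other
predictor in the class. -/
structure RefPolicy {T : ℕ} (F : Finset Predictor) (fstar : Predictor)
    (P : PMF Str) (π : Str → PMF (Resp T)) : Prop where
  expect_reward : expect (dataLaw P π) (fun z => reward fstar z.1 z.2) = 1
  margin : ∀ f ∈ F, f ≠ fstar →
    expect (dataLaw P π) (fun z => (ntpLoss fstar z : ℝ≥0∞)) + 1 / 2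
      < expect (dataLaw P π) (fun z => (ntpLoss f z : ℝ≥0∞))

/-- The training responses are random: at no prompt in the support of `P` is the response
deterministic. -/
def IsRandom {T : ℕ} (P : PMF Str) (π : Str → PMF (Resp T)) : Prop :=
  ∀ x ∈ P.support, ∀ y, π x ≠ PMF.pure y

/-- The next token loss on a training set. -/
def empLoss {T n : ℕ} (f : Predictor) (D : Fin n → Str × Resp T) : ℕ := ∑ i, ntpLoss f (D i)

open Classical in
/-- The minimizers over `F` of the next token loss on a training set. -/
noncomputable def minimizers {T n : ℕ} (F : Finset Predictor) (D : Fin n → Str × Resp T) :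
    Finset Predictor :=
  F.filter fun f => ∀ g ∈ F, empLoss f D ≤ empLoss g D

theorem minimizers_nonempty {T n : ℕ} {F : Finset Predictor} (hF : F.Nonempty)
    (D : Fin n → Str × Resp T) : (minimizers F D).Nonempty := by
  obtain ⟨f, hf, h⟩ := F.exists_min_image (fun f => empLoss f D) hF
  exact ⟨f, by simpa [minimizers] using ⟨hf, h⟩⟩

/-- The law of the predictor that supervised fine-tuning selects: draw `n` independent training
pairs, then a uniformly random minimizer of the next token loss (ties are broken at random). -/
noncomputable def sftLaw {T : ℕ} (F : Finset Predictor) (hF : F.Nonempty)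
    (P : PMF Str) (π : Str → PMF (Resp T)) (n : ℕ) : PMF Predictor :=
  (iid (dataLaw P π) n).bind fun D =>
    PMF.uniformOfFinset (minimizers F D) (minimizers_nonempty hF D)

/-- The expected reward at test time of the autoregressive map of `f`. -/
noncomputable def testReward (T : ℕ) (P : PMF Str) (fstar f : Predictor) : ℝ≥0∞ :=
  expect P fun x => reward fstar x (ar T f x)

end SFT

namespace SFT

open scoped NNReal

/-! ### Expectations under binds, pushforwards and independent draws. -/

section Expectation

variable {α β : Type}

/-! A prompt carries a fair reward bit `b` and one bit of bias `p = 3 / (4T)` for each of `N = d -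
1` competitors. The response is `b`, rarely flipped, then all `false`; the target always says
`false`. Where its own bit is `false` and nothing is flipped, a competitor ties with the target:
shown the first token `true` at `b = true`, it continues correctly. Left alone, it says `false`
there and derails, so its test reward is exactly `1 / 2` (`testReward_competitor`). Where its own
bit is `true`, it errs on all `T` tokens of an unflipped response; this has probability of order `1
/ T` and yields the margin. A competitor thus ties on the whole sample with probability at least `(r
* q) ^ n`, where `q = 1 - p` and `r` is the probability of no flip. For `n < T log d / 2` enough
competitors are expected to survive, and a second moment bound (`second_moment_bound`) shows that
one does with probability at least `1 / 2`. Competitors then make up at least half of the minimizers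
(`half_le_uniformOfFinset`), whence `1 / 4`. -/

theorem expect_const_mul (p : PMF α) (g : α → ℝ≥0∞) (c : ℝ≥0∞) :
    expect p (fun a => c * g a) = c * expect p g := by
  simp only [expect, ← ENNReal.tsum_mul_left]
  exact tsum_congr fun a => by ring

theorem expect_add (p : PMF α) (g h : α → ℝ≥0∞) :
    expect p (fun a => g a + h a) = expect p g + expect p h := by
  simp only [expect, mul_add, ENNReal.tsum_add]

theorem expect_sum {ι : Type} (p : PMF α) (s : Finset ι) (g : ι → α → ℝ≥0∞) :
    expect p (fun a => ∑ i ∈ s, g i a) = ∑ i ∈ s, expect p (g i) := by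
  simp only [expect, Finset.mul_sum]
  exact Summable.tsum_finsetSum fun i _ => ENNReal.summable

theorem expect_mono (p : PMF α) {g h : α → ℝ≥0∞} (hgh : ∀ a, g a ≤ h a) :
    expect p g ≤ expect p h :=
  ENNReal.tsum_le_tsum fun a => by gcongr; exact hgh a

theorem expect_const (p : PMF α) (c : ℝ≥0∞) : expect p (fun _ => c) = c := by
  simp only [expect, ENNReal.tsum_mul_right, p.tsum_coe, one_mul]

theorem expect_bind (p : PMF α) (q : α → PMF β) (g : β → ℝ≥0∞) :
    expect (p.bind q) g = expect p fun a => expect (q a) g := by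
  simp only [expect, PMF.bind_apply, ← ENNReal.tsum_mul_right, ← ENNReal.tsum_mul_left]
  rw [ENNReal.tsum_comm]
  exact tsum_congr fun a => tsum_congr fun b => by ring

theorem expect_pure (a : α) (g : α → ℝ≥0∞) : expect (PMF.pure a) g = g a := by
  rw [expect, tsum_eq_single a]
  · simp
  · intro b hb
    simp [PMF.pure_apply, hb]

theorem expect_map (p : PMF α) (φ : α → β) (g : β → ℝ≥0∞) :
    expect (p.map φ) g = expect p fun a => g (φ a) := by
  rw [← PMF.bind_pure_comp, expect_bind]
  simp only [Function.comp_apply, expect_pure]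

theorem expect_iid_prod (p : PMF α) (n : ℕ) (g : Fin n → α → ℝ≥0∞) :
    expect (iid p n) (fun D => ∏ j, g j (D j)) = ∏ j, expect p (g j) := by
  induction n with
  | zero => simp [iid, expect_pure]
  | succ n ih =>
    simp only [iid, expect_bind, expect_map, Fin.prod_univ_succ, Fin.cons_zero, Fin.cons_succ,
      expect_const_mul, ih]
    rw [mul_comm, ← expect_const_mul]
    simp only [mul_comm]

theorem expect_iid_prod_finset (p : PMF α) (n : ℕ) (s : Finset (Fin n)) (g : α → ℝ≥0∞) :
    expect (iid p n) (fun D => ∏ j ∈ s, g (D j)) = expect p g ^ s.card := by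
  classical
  have h := expect_iid_prod p n fun j a => if j ∈ s then g a else 1
  have h' : ∀ j, expect p (fun a => if j ∈ s then g a else 1)
      = if j ∈ s then expect p g else 1 := by
    intro j
    split_ifs
    · rfl
    · exact expect_const p 1
  simp only [h', Finset.prod_ite_mem, Finset.univ_inter, Finset.prod_const] at h
  exact h

theorem expect_iid_coord (p : PMF α) (n : ℕ) (i : Fin n) (g : α → ℝ≥0∞) :
    expect (iid p n) (fun D => g (D i)) = expect p g := by
  simpa using expect_iid_prod_finset p n {i} g

/-- The law on `Bool` giving mass `p` to `true` and mass `q` to `false`. -/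
noncomputable def coin (p q : ℝ≥0) (h : p + q = 1) : PMF Bool :=
  PMF.ofFintype (fun b => if b then (p : ℝ≥0∞) else q) (by simpa using mod_cast h)

theorem coin_apply (p q : ℝ≥0) (h : p + q = 1) (b : Bool) :
    coin p q h b = if b then (p : ℝ≥0∞) else q := rfl

theorem expect_coin (p q : ℝ≥0) (h : p + q = 1) (g : Bool → ℝ≥0∞) :
    expect (coin p q h) g = p * g true + q * g false := by
  simp [expect, tsum_fintype, coin_apply]

theorem toOuterMeasure_bind_eq_expect (p : PMF α) (q : α → PMF β) (s : Set β) :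
    (p.bind q).toOuterMeasure s = expect p fun a => (q a).toOuterMeasure s := by
  rw [PMF.toOuterMeasure_bind_apply, expect]

end Expectation

/-! ### The predictors, the data law, and their losses and rewards. -/

section Construction

/-- The tokens of a competitor as a function of the reward bit `b` and the competitor's own bit `k`
of the prompt, and of the response so far. -/
def rule : Bool → Bool → List Bool → Bool
  | false, k, [] => k
  | false, k, c :: _ => k && !c
  | true, _, [] => false
  | true, k, c :: _ => k || !c

/-- The target: always predict `false`. -/
def target : Predictor := fun _ => false

/-- The `i`-th competitor reads the bits `0` and `i + 1` of a prompt of length `N + 1`. -/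
def competitor (N : ℕ) (i : Fin N) : Predictor := fun σ =>
  rule (σ.getD 0 false) (σ.getD (i + 1) false) (σ.drop (N + 1))

/-- The response with first token `c` and all other tokens `false`. -/
def resp (T : ℕ) (c : Bool) : Resp T := fun t => c && decide ((t : ℕ) = 0)

/-- The prompt with reward bit `b` and competitors' bits `h`. -/
def prompt {N : ℕ} (b : Bool) (h : Fin N → Bool) : Str := b :: List.ofFn h

theorem length_prompt {N : ℕ} (b : Bool) (h : Fin N → Bool) : (prompt b h).length = N + 1 := by
  simp [prompt]

theorem prompt_getD_zero {N : ℕ} (b : Bool) (h : Fin N → Bool) :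
    (prompt b h).getD 0 false = b := rfl

theorem prompt_getD_succ {N : ℕ} (b : Bool) (h : Fin N → Bool) (i : Fin N) :
    (prompt b h).getD (i + 1) false = h i := by
  simp [prompt]

theorem competitor_append {N : ℕ} (i : Fin N) {x : Str} (hx : x.length = N + 1) (l : List Bool) :
    competitor N i (x ++ l) = rule (x.getD 0 false) (x.getD (i + 1) false) l := by
  have h0 : (0 : ℕ) < x.length := by omega
  have hi : (i : ℕ) + 1 < x.length := by omega
  rw [competitor, List.getD_append _ _ _ _ h0, List.getD_append _ _ _ _ hi, ← hx, List.drop_left]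

theorem app_iterate_succ (f : Predictor) (x : Str) (t : ℕ) :
    ∃ l, (app f)^[t + 1] x = x ++ f x :: l := by
  induction t with
  | zero => exact ⟨[], rfl⟩
  | succ t ih =>
    obtain ⟨l, hl⟩ := ih
    rw [Function.iterate_succ_apply', hl]
    exact ⟨l ++ [f (x ++ f x :: l)], by simp [app]⟩

theorem endToken_eq {m : ℕ} (y : Resp (m + 1)) : endToken y = some (y (Fin.last m)) := by
  rw [endToken, List.ofFn_succ', List.concat_eq_append, List.getLast?_concat]

theorem endToken_ar_target (m : ℕ) (x : Str) : endToken (ar (m + 1) target x) = some false :=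
  endToken_eq _

theorem reward_target_resp (m : ℕ) (x : Str) (c : Bool) :
    reward target x (resp (m + 2) c) = 1 := by
  rw [reward, endToken_ar_target, endToken_eq]
  simp [resp]

/-- After its own first token `c` a competitor repeats one token forever. At reward bit `false`, `c
= k` and `k && !k` is `false`; at `true`, `c = false` and `k || !c` is `true`, whatever `k` is. -/
theorem reward_target_competitor {N : ℕ} (m : ℕ) (i : Fin N) {x : Str} (hx : x.length = N + 1) :
    reward target x (ar (m + 2) (competitor N i) x) = if x.getD 0 false then 0 else 1 := by
  obtain ⟨l, hl⟩ := app_iterate_succ (competitor N i) x m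
  have h0 := competitor_append i hx []
  rw [List.append_nil] at h0
  rw [reward, endToken_ar_target, endToken_eq]
  simp only [ar, Fin.val_last, hl, competitor_append i hx, h0]
  cases x.getD 0 false <;> cases x.getD (i + 1) false <;> simp [rule]

theorem take_resp (m : ℕ) (c : Bool) (t : ℕ) :
    ∃ l, (List.ofFn (resp (m + 1) c)).take (t + 1) = c :: l := by
  rw [List.ofFn_succ, List.take_succ_cons]
  exact ⟨_, congrArg (· :: _) (by simp [resp])⟩

theorem ntpLoss_target (m : ℕ) (x : Str) (c : Bool) :
    ntpLoss target (x, resp (m + 2) c) = if c then 1 else 0 := by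
  rw [ntpLoss, Fin.sum_univ_succ]
  cases c <;> simp [target, resp]

/-- The next token loss of a competitor on the response with first token `c`. -/
def lossRule (m : ℕ) : Bool → Bool → Bool → ℕ
  | false, k, false => if k then m + 2 else 0
  | false, k, true => if k then 0 else 1
  | true, _, false => m + 1
  | true, k, true => if k then m + 2 else 1

theorem ntpLoss_competitor {N : ℕ} (m : ℕ) (i : Fin N) {x : Str} (hx : x.length = N + 1)
    (c : Bool) :
    ntpLoss (competitor N i) (x, resp (m + 2) c)
      = lossRule m (x.getD 0 false) (x.getD (i + 1) false) c := by
  have h0 := competitor_append i hx []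
  rw [List.append_nil] at h0
  have hs : ∀ t : Fin (m + 1), competitor N i
      (x ++ (List.ofFn (resp (m + 2) c)).take ((t.succ : Fin (m + 2)) : ℕ))
        = rule (x.getD 0 false) (x.getD (i + 1) false) [c] := by
    intro t
    obtain ⟨l, hl⟩ := take_resp (m + 1) c t
    rw [Fin.val_succ, hl, competitor_append i hx]
    cases x.getD 0 false <;> rfl
  rw [ntpLoss, Fin.sum_univ_succ]
  simp only [hs, Fin.val_zero, List.take_zero, List.append_nil, h0]
  cases x.getD 0 false <;> cases x.getD (i + 1) false <;> cases c <;>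
    simp [rule, resp, lossRule] <;> omega

theorem competitor_injective (N : ℕ) : Function.Injective (competitor N) := by
  intro i j hij
  by_contra hne
  -- The empty suffix brings the prompt into the form required by `competitor_append`.
  have h := congrFun hij (prompt false (fun k => decide (k = i)) ++ [])
  rw [competitor_append _ (length_prompt _ _), competitor_append _ (length_prompt _ _),
    prompt_getD_succ, prompt_getD_succ] at h
  simp [prompt, rule, Ne.symm hne] at h

theorem competitor_ne_target (N : ℕ) (i : Fin N) : competitor N i ≠ target := by
  intro h
  have h := congrFun h (prompt false (fun _ : Fin N => true) ++ [])
  rw [competitor_append _ (length_prompt _ _), prompt_getD_succ] at h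
  simp [prompt, rule, target] at h

/-- The class: the target and `N` competitors. -/
noncomputable def predictors (N : ℕ) : Finset Predictor :=
  Finset.cons target (Finset.univ.map ⟨competitor N, competitor_injective N⟩)
    (by simp [competitor_ne_target])

theorem card_predictors (N : ℕ) : (predictors N).card = N + 1 := by
  simp [predictors]

theorem mem_predictors {N : ℕ} {f : Predictor} :
    f ∈ predictors N ↔ f = target ∨ ∃ i, competitor N i = f := by
  simp [predictors]

theorem half_add_half_nnreal : (1 / 2 : ℝ≥0) + 1 / 2 = 1 := add_halves 1

/-- The law of prompts: a fair reward bit, and independent competitors' bits of bias `p`. -/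
noncomputable def promptLaw (N : ℕ) (p q : ℝ≥0) (h : p + q = 1) : PMF Str :=
  (coin (1 / 2) (1 / 2) half_add_half_nnreal).bind fun b => (iid (coin p q h) N).map (prompt b)

/-- The policy: the first token is the reward bit of the prompt, flipped with probability `e`; the
other tokens are `false`. -/
noncomputable def policy (T : ℕ) (e r : ℝ≥0) (h : e + r = 1) (x : Str) : PMF (Resp T) :=
  (coin e r h).map fun c => resp T (xor (x.getD 0 false) c)

theorem expect_dataLaw {N : ℕ} (T : ℕ) {p q e r : ℝ≥0} (hp : p + q = 1) (he : e + r = 1)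
    (g : Str × Resp T → ℝ≥0∞) :
    expect (dataLaw (promptLaw N p q hp) (policy T e r he)) g
      = expect (coin (1 / 2) (1 / 2) half_add_half_nnreal) fun b =>
        expect (iid (coin p q hp) N) fun h =>
          expect (coin e r he) fun c => g (prompt b h, resp T (xor b c)) := by
  simp only [dataLaw, promptLaw, policy, expect_bind, expect_map, prompt_getD_zero]

theorem policy_ne_pure (m : ℕ) {e r : ℝ≥0} (h : e + r = 1) (he : e ≠ 0) (hr : r ≠ 0) (x : Str)
    (y : Resp (m + 1)) : policy (m + 1) e r h x ≠ PMF.pure y := by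
  intro heq
  have hmem : ∀ c, resp (m + 1) (xor (x.getD 0 false) c) = y := by
    intro c
    have hc : resp (m + 1) (xor (x.getD 0 false) c) ∈ (policy (m + 1) e r h x).support := by
      rw [policy, PMF.support_map]
      refine ⟨c, ?_, rfl⟩
      rw [PMF.mem_support_iff, coin_apply]
      cases c <;> simpa
    rw [heq, PMF.support_pure] at hc
    exact hc
  have := congrFun ((hmem true).trans (hmem false).symm) 0
  simp [resp] at this

theorem expect_reward_dataLaw {N : ℕ} (m : ℕ) {p q e r : ℝ≥0} (hp : p + q = 1) (he : e + r = 1) :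
    expect (dataLaw (promptLaw N p q hp) (policy (m + 2) e r he))
      (fun z => reward target z.1 z.2) = 1 := by
  simp only [expect_dataLaw, reward_target_resp, expect_const]

theorem expect_ntpLoss_target {N : ℕ} (m : ℕ) {p q e r : ℝ≥0} (hp : p + q = 1) (he : e + r = 1) :
    expect (dataLaw (promptLaw N p q hp) (policy (m + 2) e r he))
      (fun z => (ntpLoss target z : ℝ≥0∞)) = ((1 / 2 : ℝ≥0) : ℝ≥0∞) := by
  simp only [expect_dataLaw, ntpLoss_target, expect_const, expect_coin]
  simp only [Bool.xor_true, Bool.xor_false, Bool.not_true, Bool.not_false, if_true,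
    Bool.false_eq_true, if_false, Nat.cast_one, Nat.cast_zero, mul_one, mul_zero, zero_add,
    add_zero]
  norm_cast
  rw [← mul_add, add_comm r e, he, mul_one]

theorem expect_ntpLoss_competitor {N : ℕ} (m : ℕ) {p q e r : ℝ≥0} (hp : p + q = 1)
    (he : e + r = 1) (i : Fin N) :
    expect (dataLaw (promptLaw N p q hp) (policy (m + 2) e r he))
      (fun z => (ntpLoss (competitor N i) z : ℝ≥0∞))
      = ((1 / 2 * (p * (e * (m + 1) + r * (m + 2)) + q * (e * (m + 1) + r))
          + 1 / 2 * (p * (r * (m + 2)) + q * e) : ℝ≥0) : ℝ≥0∞) := by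
  simp only [expect_dataLaw, ntpLoss_competitor m i (length_prompt _ _), prompt_getD_zero,
    prompt_getD_succ]
  have h : ∀ b, expect (iid (coin p q hp) N) (fun h => expect (coin e r he)
        fun c => (lossRule m b (h i) (xor b c) : ℝ≥0∞))
      = expect (coin p q hp) fun k => expect (coin e r he)
        fun c => (lossRule m b k (xor b c) : ℝ≥0∞) := fun b =>
    expect_iid_coord (coin p q hp) N i fun k => expect (coin e r he)
      fun c => (lossRule m b k (xor b c) : ℝ≥0∞)
  simp only [h]
  simp only [expect_coin, lossRule]
  push_cast
  simp

theorem testReward_competitor {N : ℕ} (m : ℕ) {p q : ℝ≥0} (hp : p + q = 1) (i : Fin N) :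
    testReward (m + 2) (promptLaw N p q hp) target (competitor N i) = 1 / 2 := by
  simp only [testReward, promptLaw, expect_bind, expect_map,
    reward_target_competitor m i (length_prompt _ _), prompt_getD_zero, expect_const, expect_coin]
  simp [expect_const]

end Construction

/-! ### Second moment method for the competitors that tie with the target. -/

section Survival

/-- The training pairs with a prompt at which the `i`-th competitor's bit is `false` and with the
response that the policy gives without a flip. -/
def spared (N T : ℕ) (i : Fin N) : Set (Str × Resp T) :=
  {z | z.1.length = N + 1 ∧ z.1.getD (i + 1) false = false ∧ z.2 = resp T (z.1.getD 0 false)}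

theorem ntpLoss_competitor_le {N m : ℕ} {i : Fin N} {z : Str × Resp (m + 2)}
    (hz : z ∈ spared N (m + 2) i) : ntpLoss (competitor N i) z ≤ ntpLoss target z := by
  obtain ⟨x, y⟩ := z
  obtain ⟨hx, hi, hy⟩ := hz
  dsimp only at hx hi hy
  rw [hy, ntpLoss_competitor m i hx, ntpLoss_target, hi]
  cases x.getD 0 false <;> simp [lossRule]

theorem resp_injective (m : ℕ) : Function.Injective (resp (m + 1)) := by
  intro a b hab
  simpa [resp] using congrFun hab 0

theorem indicator_spared {N m : ℕ} (i : Fin N) (b c : Bool) (h : Fin N → Bool) :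
    (spared N (m + 1) i).indicator (1 : Str × Resp (m + 1) → ℝ≥0∞)
        (prompt b h, resp (m + 1) (xor b c))
      = (if c then 0 else 1) * (if h i then 0 else 1) := by
  simp only [Set.indicator, spared, Set.mem_ofPred_eq, length_prompt, prompt_getD_succ,
    prompt_getD_zero, (resp_injective m).eq_iff, Pi.one_apply]
  cases b <;> cases c <;> cases h i <;> simp

/-- The flip is common to all competitors, so `r` enters once; their bits are independent, so each
contributes a factor `q`. -/
theorem expect_prod_indicator_spared {N m : ℕ} {p q e r : ℝ≥0} (hp : p + q = 1) (he : e + r = 1)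
    {s : Finset (Fin N)} (hs : s.Nonempty) :
    expect (dataLaw (promptLaw N p q hp) (policy (m + 1) e r he))
      (fun z => ∏ i ∈ s, (spared N (m + 1) i).indicator 1 z) = r * (q : ℝ≥0∞) ^ s.card := by
  have h0 : ∀ h : Fin N → Bool, ∏ i ∈ s, ((0 : ℝ≥0∞) * if h i then 0 else 1) = 0 := by
    intro h
    obtain ⟨i, hi⟩ := hs
    exact Finset.prod_eq_zero hi (zero_mul _)
  have h1 : expect (iid (coin p q hp) N) (fun h => ∏ i ∈ s, if h i then (0 : ℝ≥0∞) else 1)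
      = (q : ℝ≥0∞) ^ s.card := by
    rw [expect_iid_prod_finset (coin p q hp) N s fun k => if k then (0 : ℝ≥0∞) else 1, expect_coin]
    simp
  have h2 : ∀ h : Fin N → Bool, expect (coin e r he)
      (fun c => ∏ i ∈ s, ((if c then (0 : ℝ≥0∞) else 1) * if h i then 0 else 1))
        = r * ∏ i ∈ s, if h i then (0 : ℝ≥0∞) else 1 := by
    intro h
    rw [expect_coin]
    simp only [if_true, h0, mul_zero, zero_add, Bool.false_eq_true, if_false, one_mul]
  simp only [expect_dataLaw, indicator_spared, h2, expect_const_mul, h1, expect_const]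

/-- The indicator of the event that all pairs of a training set spare the `i`-th competitor. -/
noncomputable def survives {N T n : ℕ} (i : Fin N) (D : Fin n → Str × Resp T) : ℝ≥0∞ :=
  ∏ j, (spared N T i).indicator 1 (D j)

theorem survives_mul_self {N T n : ℕ} (i : Fin N) (D : Fin n → Str × Resp T) :
    survives i D * survives i D = survives i D := by
  rw [survives, ← Finset.prod_mul_distrib]
  refine Finset.prod_congr rfl fun j _ => ?_
  by_cases h : D j ∈ spared N T i <;> simp [h]

theorem empLoss_competitor_le {N m n : ℕ} {i : Fin N} {D : Fin n → Str × Resp (m + 2)}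
    (h : survives i D ≠ 0) : empLoss (competitor N i) D ≤ empLoss target D := by
  refine Finset.sum_le_sum fun j hj => ntpLoss_competitor_le (i := i) ?_
  by_contra hn
  exact h (Finset.prod_eq_zero hj (Set.indicator_of_notMem hn _))

theorem expect_prod_survives {N m n : ℕ} {p q e r : ℝ≥0} (hp : p + q = 1) (he : e + r = 1)
    {s : Finset (Fin N)} (hs : s.Nonempty) :
    expect (iid (dataLaw (promptLaw N p q hp) (policy (m + 1) e r he)) n)
      (fun D => ∏ i ∈ s, survives i D) = (r * (q : ℝ≥0∞) ^ s.card) ^ n := by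
  simp only [survives]
  simp_rw [Finset.prod_comm (s := s)]
  rw [expect_iid_prod _ n fun _ z => ∏ i ∈ s, (spared N (m + 1) i).indicator 1 z]
  simp [expect_prod_indicator_spared hp he hs]

theorem expect_survives {N m n : ℕ} {p q e r : ℝ≥0} (hp : p + q = 1) (he : e + r = 1)
    (i : Fin N) :
    expect (iid (dataLaw (promptLaw N p q hp) (policy (m + 1) e r he)) n) (survives i)
      = (r : ℝ≥0∞) ^ n * (q : ℝ≥0∞) ^ n := by
  simpa [mul_pow] using
    expect_prod_survives (m := m) (n := n) hp he (Finset.singleton_nonempty i)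

theorem expect_survives_mul_le {N m n : ℕ} {p q e r : ℝ≥0} (hp : p + q = 1) (he : e + r = 1)
    (i k : Fin N) :
    expect (iid (dataLaw (promptLaw N p q hp) (policy (m + 1) e r he)) n)
        (fun D => survives i D * survives k D)
      ≤ (r : ℝ≥0∞) ^ n * ((q : ℝ≥0∞) ^ n) ^ 2
        + if i = k then (r : ℝ≥0∞) ^ n * (q : ℝ≥0∞) ^ n else 0 := by
  by_cases hik : i = k
  · subst hik
    simp only [survives_mul_self, if_true]
    exact (expect_survives hp he i).le.trans le_add_self
  · have h := expect_prod_survives (m := m) (n := n) hp he (Finset.insert_nonempty i {k})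
    simp only [Finset.prod_pair hik, Finset.card_pair hik] at h
    rw [h, if_neg hik, add_zero, mul_pow, pow_right_comm]

/-- The target is the only possible minimizer outside `A`, and if it is a minimizer then so is
competitor `i`. -/
theorem half_le_uniformOfFinset {N m n : ℕ} {A : Set Predictor} (hA : ∀ i, competitor N i ∈ A)
    {D : Fin n → Str × Resp (m + 2)} {i : Fin N}
    (hi : empLoss (competitor N i) D ≤ empLoss target D)
    (hM : (minimizers (predictors N) D).Nonempty) :
    1 ≤ 2 * (PMF.uniformOfFinset (minimizers (predictors N) D) hM).toOuterMeasure A := by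
  classical
  set M := minimizers (predictors N) D with hMdef
  have hmem : ∀ f, f ∈ M ↔ f ∈ predictors N ∧ ∀ g ∈ predictors N, empLoss f D ≤ empLoss g D := by
    intro f
    simp [hMdef, minimizers]
  have hsub : M ⊆ insert target (M.filter (· ∈ A)) := by
    intro f hf
    rcases mem_predictors.1 ((hmem f).1 hf).1 with rfl | ⟨k, rfl⟩
    · exact Finset.mem_insert_self _ _
    · exact Finset.mem_insert_of_mem (Finset.mem_filter.2 ⟨hf, hA k⟩)
  have hpos : 0 < (M.filter (· ∈ A)).card := by
    rw [Finset.card_pos]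
    obtain ⟨f, hf⟩ := hM
    rcases mem_predictors.1 ((hmem f).1 hf).1 with rfl | ⟨k, rfl⟩
    · refine ⟨competitor N i, Finset.mem_filter.2 ⟨(hmem _).2 ⟨mem_predictors.2 (.inr ⟨i, rfl⟩),
        fun g hg => hi.trans (((hmem _).1 hf).2 g hg)⟩, hA i⟩⟩
    · exact ⟨_, Finset.mem_filter.2 ⟨hf, hA k⟩⟩
  have hcard : M.card ≤ 2 * (M.filter (· ∈ A)).card := by
    have := (Finset.card_le_card hsub).trans (Finset.card_insert_le _ _)
    omega
  rw [PMF.toOuterMeasure_uniformOfFinset_apply, ← mul_div_assoc,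
    ENNReal.le_div_iff_mul_le (.inl (by simpa using hM.ne_empty)) (.inl (by simp)), one_mul]
  exact_mod_cast hcard

theorem two_mul_le_one_add_sq (x : ℝ≥0∞) : 2 * x ≤ 1 + x ^ 2 := by
  induction x using ENNReal.recTopCoe with
  | top => simp
  | coe x =>
    norm_cast
    rw [← NNReal.coe_le_coe]
    push_cast
    nlinarith [sq_nonneg ((x : ℝ) - 1)]

/-- With `Z` the number of survivors, `2aZ ≤ 1 + (aZ)²` gives `2aZ ≤ 𝟏{Z ≠ 0} + (aZ)²`; take
expectations. This linear form of the second moment method avoids division; `a` is optimized later.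
-/
theorem second_moment_bound {N m n : ℕ} {p q e r : ℝ≥0} (hp : p + q = 1) (he : e + r = 1)
    {A : Set Predictor} (hA : ∀ i, competitor N i ∈ A) (hF : (predictors N).Nonempty) (a : ℝ≥0∞) :
    2 * (a * (N * (r ^ n * q ^ n)))
      ≤ 2 * (sftLaw (predictors N) hF (promptLaw N p q hp)
          (policy (m + 2) e r he) n).toOuterMeasure A
        + a ^ 2 * (N ^ 2 * (r ^ n * (q ^ n) ^ 2) + N * (r ^ n * q ^ n)) := by
  set L := iid (dataLaw (promptLaw N p q hp) (policy (m + 2) e r he)) n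
  have h1 : expect L (fun D => 2 * (a * ∑ i : Fin N, survives i D))
      = 2 * (a * (N * (r ^ n * q ^ n))) := by
    simp only [expect_const_mul, expect_sum]
    simp [L, expect_survives hp he]
  have h2 : expect L (fun D => a ^ 2 * ∑ i : Fin N, ∑ k : Fin N, survives i D * survives k D)
      ≤ a ^ 2 * (N ^ 2 * (r ^ n * (q ^ n) ^ 2) + N * (r ^ n * q ^ n)) := by
    simp only [expect_const_mul, expect_sum]
    gcongr
    refine (Finset.sum_le_sum fun i _ => Finset.sum_le_sum fun k _ =>
      expect_survives_mul_le hp he i k).trans_eq ?_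
    simp [Finset.sum_add_distrib, sq, mul_assoc]
  rw [← h1, sftLaw, toOuterMeasure_bind_eq_expect, ← expect_const_mul]
  refine le_trans ?_ (add_le_add_right h2 _)
  rw [← expect_add]
  refine expect_mono _ fun D => ?_
  rw [← Finset.sum_mul_sum, ← sq, ← mul_pow]
  by_cases h : ∃ i : Fin N, survives i D ≠ 0
  · obtain ⟨i, hi⟩ := h
    exact (two_mul_le_one_add_sq _).trans
      (by gcongr; exact half_le_uniformOfFinset hA (empLoss_competitor_le hi) _)
  · push Not at h
    simp [h]

end Survival

/-! ### Estimates on the sample size. -/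

section Numerics

/-- As `q⁻¹ ≤ exp (3 / (4T - 3))` and `3T / (2(4T - 3)) ≤ 3 / 5` for `T ≥ 2`, one gets `q ^ n ≥ (N +
1) ^ (-3/5)`. Fifth powers clear the exponent. -/
theorem three_halves_le_mul_pow {T N n : ℕ} (hT : 2 ≤ T) (hN : 5 ≤ N) {p q : ℝ}
    (hp : p = 3 / (4 * T)) (hq : p + q = 1)
    (hn : (n : ℝ) < Real.log ((N + 1 : ℕ) : ℝ) * T / 2) : 3 / 2 ≤ N * q ^ n := by
  have hT' : (2 : ℝ) ≤ T := by exact_mod_cast hT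
  have hN' : (5 : ℝ) ≤ N := by exact_mod_cast hN
  push_cast at hn
  set l := Real.log (N + 1)
  have hl : 0 ≤ l := Real.log_nonneg (by linarith)
  have hq0 : q = (4 * T - 3) / (4 * T) := by
    have : q = 1 - p := by linarith
    rw [this, hp]
    field_simp
  have h43 : (0 : ℝ) < 4 * T - 3 := by linarith
  have hqpos : 0 < q := by rw [hq0]; positivity
  have hinv : q⁻¹ ≤ Real.exp (3 / (4 * T - 3)) := by
    have : q⁻¹ = 3 / (4 * T - 3) + 1 := by
      rw [hq0]
      field_simp
      ring
    rw [this]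
    exact Real.add_one_le_exp _
  have hexp : 5 * (n * (3 / (4 * T - 3))) ≤ 3 * l := by
    have h1 : (n : ℝ) * (3 / (4 * T - 3)) ≤ l * T / 2 * (3 / (4 * T - 3)) := by gcongr
    have h2 : 5 * (l * T / 2 * (3 / (4 * T - 3))) ≤ 3 * l := by
      rw [show 5 * (l * T / 2 * (3 / (4 * T - 3))) = (15 * (l * T) / 2) / (4 * T - 3) by ring,
        div_le_iff₀ h43]
      nlinarith
    linarith
  have hpow : ((q ^ n) ^ 5)⁻¹ ≤ ((N : ℝ) + 1) ^ 3 := by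
    rw [← inv_pow, ← inv_pow]
    calc (q⁻¹ ^ n) ^ 5 ≤ (Real.exp (3 / (4 * T - 3)) ^ n) ^ 5 := by gcongr
      _ = Real.exp (5 * (n * (3 / (4 * T - 3)))) := by
        rw [← Real.exp_nat_mul, ← Real.exp_nat_mul]
        norm_num
      _ ≤ Real.exp (3 * l) := by gcongr
      _ = ((N : ℝ) + 1) ^ 3 := by
        rw [show (3 : ℝ) * l = ((3 : ℕ) : ℝ) * l by norm_num, Real.exp_nat_mul,
          Real.exp_log (by linarith)]
  have hv : 0 < q ^ n := by positivity
  have hmul : 1 ≤ ((N : ℝ) + 1) ^ 3 * (q ^ n) ^ 5 := by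
    rwa [inv_le_iff_one_le_mul₀ (by positivity)] at hpow
  have hpoly : (3 / 2 : ℝ) ^ 5 * ((N : ℝ) + 1) ^ 3 ≤ (N : ℝ) ^ 5 := by
    have h1 : ((N : ℝ) + 1) ^ 3 ≤ (6 / 5 * N) ^ 3 := by gcongr; linarith
    have h2 : (25 : ℝ) ≤ N ^ 2 := by nlinarith
    have h3 : (0 : ℝ) < N ^ 3 := by positivity
    nlinarith
  refine le_of_pow_le_pow_left₀ (n := 5) (by norm_num) (by positivity) ?_
  calc (3 / 2 : ℝ) ^ 5 ≤ (3 / 2 : ℝ) ^ 5 * (((N : ℝ) + 1) ^ 3 * (q ^ n) ^ 5) :=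
        le_mul_of_one_le_right (by positivity) hmul
    _ = (3 / 2 : ℝ) ^ 5 * ((N : ℝ) + 1) ^ 3 * (q ^ n) ^ 5 := by ring
    _ ≤ (N : ℝ) ^ 5 * (q ^ n) ^ 5 := by gcongr
    _ = (N * q ^ n) ^ 5 := by ring

theorem five_sixths_le_pow {T N n : ℕ} (hT : 2 ≤ T) {e r : ℝ}
    (he : e = 1 / (6 * T * (N + 1))) (hr : e + r = 1)
    (hn : (n : ℝ) < Real.log ((N + 1 : ℕ) : ℝ) * T / 2) : 5 / 6 ≤ r ^ n := by
  have hT' : (2 : ℝ) ≤ T := by exact_mod_cast hT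
  have hN' : (0 : ℝ) ≤ N := Nat.cast_nonneg N
  push_cast at hn
  have hlog : Real.log (N + 1) ≤ N + 1 := (Real.log_le_sub_one_of_pos (by linarith)).trans (by simp)
  have hn' : (n : ℝ) ≤ T * (N + 1) := by nlinarith
  have he' : e ≤ 1 := by
    rw [he, div_le_one (by positivity)]
    nlinarith
  have hne : n * e ≤ 1 / 6 := by
    rw [he, mul_one_div, div_le_iff₀ (by positivity)]
    linarith
  have h := one_add_mul_le_pow (a := -e) (by linarith) n
  rw [show r = 1 + -e by linarith]
  linarith

end Numerics

/-! ### Margin and success probability for the chosen parameters. -/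

section Parameters

theorem expect_ntpLoss_target_add_half_lt {N m : ℕ} {p q e r : ℝ≥0} (hp : p + q = 1)
    (he : e + r = 1) (hpm : (p : ℝ) = 3 / (4 * ((m + 2 : ℕ) : ℝ))) (hr : (35 / 36 : ℝ) ≤ r)
    (i : Fin N) :
    expect (dataLaw (promptLaw N p q hp) (policy (m + 2) e r he))
        (fun z => (ntpLoss target z : ℝ≥0∞)) + 1 / 2
      < expect (dataLaw (promptLaw N p q hp) (policy (m + 2) e r he))
        (fun z => (ntpLoss (competitor N i) z : ℝ≥0∞)) := by
  rw [expect_ntpLoss_target, expect_ntpLoss_competitor,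
    show (1 / 2 : ℝ≥0∞) = ((1 / 2 : ℝ≥0) : ℝ≥0∞) by simp, ← ENNReal.coe_add, ENNReal.coe_lt_coe,
    ← NNReal.coe_lt_coe]
  have hp' : (p : ℝ) + q = 1 := by exact_mod_cast hp
  push_cast at hpm ⊢
  have hm : (0 : ℝ) ≤ m := Nat.cast_nonneg m
  have h1 : (p : ℝ) * (m + 2) = 3 / 4 := by
    rw [hpm]
    field_simp
  have h2 : (p : ℝ) ≤ 3 / 8 := by nlinarith [mul_nonneg p.coe_nonneg hm]
  have h3 : (0 : ℝ) ≤ p * (e * (m + 1)) + q * (e * (m + 1)) + q * e := by positivity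
  -- Here `17 / 8 = 2 * (3 / 4) + 5 / 8`. The left side exceeds `2`, which after the factor `1 / 2`
  -- of the fair bit beats `1 / 2 + 1 / 2`.
  have h4 : (35 / 36 : ℝ) * (17 / 8) ≤ r * (2 * (p * (m + 2)) + q) := by
    gcongr
    linarith
  linarith

theorem quarter_le_sftLaw {N m n : ℕ} (hN : 5 ≤ N) {p q e r : ℝ≥0} (hp : p + q = 1)
    (he : e + r = 1) (hpm : (p : ℝ) = 3 / (4 * ((m + 2 : ℕ) : ℝ)))
    (heN : (e : ℝ) = 1 / (6 * ((m + 2 : ℕ) : ℝ) * (N + 1)))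
    (hn : (n : ℝ) < Real.log ((N + 1 : ℕ) : ℝ) * ((m + 2 : ℕ) : ℝ) / 2)
    {A : Set Predictor} (hA : ∀ i, competitor N i ∈ A) (hF : (predictors N).Nonempty) :
    1 / 4 ≤ (sftLaw (predictors N) hF (promptLaw N p q hp)
      (policy (m + 2) e r he) n).toOuterMeasure A := by
  have hp' : (p : ℝ) + q = 1 := by exact_mod_cast hp
  have he' : (e : ℝ) + r = 1 := by exact_mod_cast he
  have hx := three_halves_le_mul_pow (by omega) hN hpm hp' hn
  have hu := five_sixths_le_pow (by omega) heN he' hn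
  -- This scale minimizes the quadratic in `a`, leaving `2W ≥ u * N * v / (1 + N * v)` with `u = r ^
  -- n`, `v = q ^ n`; this is at least `(5 / 6) * (3 / 5) = 1 / 2`.
  have h := second_moment_bound (m := m) (n := n) hp he hA hF
    (((1 + N * q ^ n)⁻¹ : ℝ≥0) : ℝ≥0∞)
  by_contra! hlt
  generalize (sftLaw (predictors N) hF (promptLaw N p q hp)
    (policy (m + 2) e r he) n).toOuterMeasure A = W at h hlt
  lift W to ℝ≥0 using hlt.ne_top
  rw [show (1 / 4 : ℝ≥0∞) = ((1 / 4 : ℝ≥0) : ℝ≥0∞) by simp, ENNReal.coe_lt_coe,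
    ← NNReal.coe_lt_coe] at hlt
  norm_cast at h
  rw [← NNReal.coe_le_coe] at h
  push_cast at h hlt
  generalize (r : ℝ) ^ n = u at *
  generalize (q : ℝ) ^ n = v at *
  have hpos : (0 : ℝ) < 1 + N * v := by linarith
  have h2 : 2 * (u * (N * v)) * (1 + N * v)⁻¹
      ≤ 2 * (W : ℝ) + u * (N * v) * (1 + N * v)⁻¹ := by
    refine (le_of_eq (by ring)).trans (h.trans (le_of_eq ?_))
    field_simp
    ring
  have h3 : 1 / 2 ≤ u * (N * v) * (1 + N * v)⁻¹ := by
    rw [← div_eq_mul_inv, le_div_iff₀ hpos]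
    nlinarith
  linarith

end Parameters

end SFT

theorem mainTheorem4 (T d : ℕ) (hT : 2 ≤ T) (hd : 5 < d) (hTd : T < d) :
    ∃ (F : Finset SFT.Predictor) (P : PMF SFT.Str) (π : SFT.Str → PMF (SFT.Resp T))
      (fstar : SFT.Predictor) (hf : fstar ∈ F),
      F.card = d ∧ SFT.IsRandom P π ∧ SFT.RefPolicy F fstar P π ∧
      ∀ n : ℕ, (n : ℝ) < Real.log (F.card : ℝ) * (T : ℝ) / 2 →
        1 / 4 ≤ (SFT.sftLaw F ⟨fstar, hf⟩ P π n).toOuterMeasure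
          {f | SFT.testReward T P fstar f = 1 / 2} := by
  obtain ⟨m, rfl⟩ : ∃ m, T = m + 2 := ⟨T - 2, by omega⟩
  obtain ⟨N, rfl⟩ : ∃ N, d = N + 1 := ⟨d - 1, by omega⟩
  have hm : (0 : ℝ) ≤ m := Nat.cast_nonneg m
  have hN : (5 : ℝ) ≤ N := by exact_mod_cast (by omega : 5 ≤ N)
  let p : NNReal := 3 / (4 * ((m + 2 : ℕ) : NNReal))
  -- Positive, so that responses are random, yet `n * e ≤ 1 / 6`, so that a flip in the sample is
  -- unlikely.
  let e : NNReal := 1 / (6 * ((m + 2 : ℕ) : NNReal) * (N + 1))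
  have hpm : (p : ℝ) = 3 / (4 * ((m + 2 : ℕ) : ℝ)) := by simp [p]
  have heN : (e : ℝ) = 1 / (6 * ((m + 2 : ℕ) : ℝ) * (N + 1)) := by simp [e]
  have hp1 : p ≤ 1 := by
    rw [← NNReal.coe_le_coe, hpm, NNReal.coe_one, div_le_one (by positivity)]
    push_cast
    linarith
  have he36 : (e : ℝ) ≤ 1 / 36 := by
    rw [heN]
    push_cast
    gcongr
    nlinarith
  have he1 : e ≤ 1 := by
    rw [← NNReal.coe_le_coe, NNReal.coe_one]
    linarith
  have he0 : e ≠ 0 := by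
    rw [← NNReal.coe_ne_zero, heN]
    positivity
  have hr : (35 / 36 : ℝ) ≤ ((1 - e : NNReal) : ℝ) := by
    rw [NNReal.coe_sub he1, NNReal.coe_one]
    linarith
  have hr0 : 1 - e ≠ 0 := by
    rw [← NNReal.coe_ne_zero]
    linarith
  have hp := add_tsub_cancel_of_le hp1
  have he := add_tsub_cancel_of_le he1
  refine ⟨SFT.predictors N, SFT.promptLaw N p (1 - p) hp, SFT.policy (m + 2) e (1 - e) he,
    SFT.target, SFT.mem_predictors.2 (.inl rfl), SFT.card_predictors N,
    fun x _ y => SFT.policy_ne_pure _ he he0 hr0 x y,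
    ⟨SFT.expect_reward_dataLaw m hp he, fun f hf hne => ?_⟩, fun n hn => ?_⟩
  · obtain rfl | ⟨i, rfl⟩ := SFT.mem_predictors.1 hf
    · exact absurd rfl hne
    · exact SFT.expect_ntpLoss_target_add_half_lt hp he hpm hr i
  · rw [SFT.card_predictors] at hn
    exact SFT.quarter_le_sftLaw (by omega) hp he hpm heN hn
      (fun i => SFT.testReward_competitor m hp i) _
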